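/- Let $H$ be a complex Hilbert space and let $A \subseteq \mathcal{B}(H)$ be a C*-algebra of operators on $H$ (not necessarily unital; for instance, any C*-algebra in its reduced atomic representation). For a C*-algebra $C$ of operators on $H$ put $C_+=\{c^*c : c\in C\}$, and let $\mathcal{H}(C)$ be the set of hereditary C*-subalgebras of $C$, i.e. of those C*-subalgebras $D\subseteq C$ such that $c\in D$ whenever $c\in C_+$, $d\in C_+\cap D$ and $d-c\in C_+$; it is ordered by inclusion, with least element $\{0\}$. For $B\in\mathcal{H}(A)$ let $p_B=\bigvee\{b\in B_+ : \|b\|\le 1\}$, which is the orthogonal projection onto the closed linear span of $BH$ and lies in $A''$. For $S\subseteq A$ let $S^\perp=\{a\in A : ba=0=ba^*\text{ for all }b\in S\}$; the $*$-annihilators of $A$ are the sets $S^\perp$ with $S \subseteq A$, or equivalently the sets $S\subseteq A$ with $S=S^{\perp\perp}$. Let $B\in\mathcal{H}(A)$ satisfy $B=B^{\perp\perp}$. Then: (1) $B$ is $\varepsilon$-SSC for every $\varepsilon>0$: for every $\varepsilon > 0$ and every $C\in\mathcal{H}(A)$ with $B\subsetneq C$ there is $D\in\mathcal{H}(C)$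 with $D\neq\{0\}$ and $\|p_Bp_D\|<\varepsilon$. (2) $B$ is SSC (section $\wedge$-semicomplemented) in $\mathcal{H}(A)$: for every $C\in\mathcal{H}(A)$ with $B\subsetneq C$ there is $D\in\mathcal{H}(A)$ with $D\neq\{0\}$, $D\subseteq C$ and $B\wedge D=\{0\}$ in $\mathcal{H}(A)$. -/

import Mathlib

open Filter Topology

noncomputable section

/-! ### Hereditary C*-subalgebras

All C*-algebras are concrete: norm closed *-subalgebras `A` of the bounded operators `H →L[ℂ] H`
on a complex Hilbert space `H`.  They need not contain the identity operator. -/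

/-- The *-subalgebras (not necessarily closed, not necessarily unital) of `B(H)`. -/
abbrev OpStarSubalgebra (H : Type*) [NormedAddCommGroup H] [InnerProductSpace ℂ H]
    [CompleteSpace H] := NonUnitalStarSubalgebra ℂ (H →L[ℂ] H)

section

variable {H : Type*} [NormedAddCommGroup H] [InnerProductSpace ℂ H] [CompleteSpace H]

/-- The positive elements `A₊ = {a⋆a : a ∈ A}`. -/
def posCone (A : OpStarSubalgebra H) : Set (H →L[ℂ] H) :=
  {x | ∃ a ∈ A, x = star a * a}

/-- `B` is a hereditary C*-subalgebra of `A`: a norm closed *-subalgebra `B ⊆ A` such that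
`a ≤ b ∈ B` implies `a ∈ B`, for `a, b ∈ A₊`, where `a ≤ b` means `b - a ∈ A₊`. -/
structure IsHereditaryCStarSubalgebra (A B : OpStarSubalgebra H) : Prop where
  le : B ≤ A
  isClosed : IsClosed (B : Set (H →L[ℂ] H))
  hereditary : ∀ a ∈ posCone A, ∀ b ∈ posCone A, b - a ∈ posCone A → b ∈ B → a ∈ B

/-- `ℋ(A)`, the hereditary C*-subalgebras of `A`, ordered by inclusion. -/
abbrev HerSub (A : OpStarSubalgebra H) : Type _ :=
  {B : OpStarSubalgebra H // IsHereditaryCStarSubalgebra A B}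

/-- The *-subalgebra `{0}`. -/
def zeroSub (H : Type*) [NormedAddCommGroup H] [InnerProductSpace ℂ H] [CompleteSpace H] :
    OpStarSubalgebra H where
  carrier := {0}
  add_mem' := by rintro _ _ rfl rfl; simp
  zero_mem' := rfl
  mul_mem' := by rintro _ _ rfl rfl; simp
  smul_mem' := by rintro c _ rfl; simp
  star_mem' := by rintro _ rfl; simp

lemma zeroSub_le (A : OpStarSubalgebra H) : zeroSub H ≤ A := by
  rintro _ rfl
  exact zero_mem A

lemma isHereditaryCStarSubalgebra_zeroSub (A : OpStarSubalgebra H) :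
    IsHereditaryCStarSubalgebra A (zeroSub H) where
  le := zeroSub_le A
  isClosed := isClosed_singleton
  hereditary := by
    rintro a ⟨x, -, rfl⟩ b - ⟨y, -, hy⟩ hb
    obtain rfl : b = 0 := hb
    change star x * x = 0
    apply le_antisymm
    · rw [← sub_nonneg, hy]
      exact star_mul_self_nonneg y
    · exact star_mul_self_nonneg x

/-- The least element of `ℋ(A)` is `{0}`. -/
instance (A : OpStarSubalgebra H) : OrderBot (HerSub A) where
  bot := ⟨zeroSub H, isHereditaryCStarSubalgebra_zeroSub A⟩
  bot_le B := zeroSub_le B.1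

/-! ### *-annihilators -/

/-- `S^⊥ = {a ∈ A : ∀ b ∈ S, ba = 0 = ba⋆}`, for subsets `S` of `A`. -/
def starAnnihilator (A : OpStarSubalgebra H) (S : Set (H →L[ℂ] H)) : Set (H →L[ℂ] H) :=
  {a | a ∈ A ∧ ∀ b ∈ S, b * a = 0 ∧ b * star a = 0}

/-- The sets `T^⊥` with `T ⊆ A` (the *-annihilators of `A`) are precisely the sets that equal
their double annihilator. -/
lemma exists_eq_starAnnihilator_iff (A : OpStarSubalgebra H) (S : Set (H →L[ℂ] H)) :
    (∃ T ⊆ (A : Set (H →L[ℂ] H)), S = starAnnihilator A T) ↔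
      S = starAnnihilator A (starAnnihilator A S) := by
  constructor
  · rintro ⟨T, hT, rfl⟩
    have hz : ∀ t a : H →L[ℂ] H, star t * t * a = 0 ↔ t * a = 0 := by
      intro t a
      constructor
      · intro h
        rw [← CStarRing.star_mul_self_eq_zero_iff, star_mul, mul_assoc, ← mul_assoc (star t), h,
          mul_zero]
      · intro h
        rw [mul_assoc, h, mul_zero]
    have hadj : ∀ R : Set (H →L[ℂ] H), ∀ b ∈ starAnnihilator A R, star b ∈ starAnnihilator A R :=
      fun R b hb => ⟨star_mem hb.1, fun c hc => ⟨(hb.2 c hc).2, by simpa using (hb.2 c hc).1⟩⟩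
    have hstar : ∀ R : Set (H →L[ℂ] H), R ⊆ A → (∀ r ∈ R, star r ∈ R) →
        R ⊆ starAnnihilator A (starAnnihilator A R) := by
      intro R hR hs r hr
      refine ⟨hR hr, fun b hb => ⟨?_, ?_⟩⟩
      · simpa using congrArg star (hb.2 (star r) (hs r hr)).2
      · simpa using congrArg star (hb.2 r hr).2
    set U : Set (H →L[ℂ] H) := {u | ∃ t ∈ T, u = star t * t} with hU
    have hTU : starAnnihilator A T = starAnnihilator A U := by
      ext a
      constructor
      · rintro ⟨ha, h⟩
        refine ⟨ha, ?_⟩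
        rintro _ ⟨t, ht, rfl⟩
        exact ⟨(hz t a).2 (h t ht).1, (hz t _).2 (h t ht).2⟩
      · rintro ⟨ha, h⟩
        exact ⟨ha, fun t ht => ⟨(hz t a).1 (h _ ⟨t, ht, rfl⟩).1, (hz t _).1 (h _ ⟨t, ht, rfl⟩).2⟩⟩
    have hUA : U ⊆ A := by
      rintro _ ⟨t, ht, rfl⟩
      exact mul_mem (star_mem (hT ht)) (hT ht)
    have hUs : ∀ u ∈ U, star u ∈ U := by
      rintro _ ⟨t, ht, rfl⟩
      exact ⟨t, ht, by simp⟩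
    rw [hTU]
    apply Set.Subset.antisymm
    · exact hstar _ (fun a ha => ha.1) (hadj U)
    · rintro a ⟨ha, h⟩
      exact ⟨ha, fun b hb => h b (hstar U hUA hUs hb)⟩
  · intro h
    exact ⟨starAnnihilator A S, fun a ha => ha.1, h⟩

/-! ### Open projections -/

/-- The closed linear span of `{b v : b ∈ B, v ∈ H}`. -/
def closedRange (B : OpStarSubalgebra H) : Submodule ℂ H :=
  (Submodule.span ℂ {w : H | ∃ b ∈ B, ∃ v, b v = w}).topologicalClosure

instance (B : OpStarSubalgebra H) : CompleteSpace (closedRange B) :=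
  (Submodule.isClosed_topologicalClosure _).completeSpace_coe

/-- The open projection `p_B`, as an operator on `H`: the orthogonal projection onto the closed
linear span of `B H`.  By `isLUB_openProj`, `openProj_mem_doubleCommutant` and
`isStarProjection_openProj` below, this is the supremum `⋁ B¹₊` of the positive part of the unit
ball of `B`, and it is a projection of the double commutant of any `A ⊇ B`. -/
def openProj (B : OpStarSubalgebra H) : H →L[ℂ] H :=
  (closedRange B).starProjection

/-- `B¹₊`, the positive part of the closed unit ball of `B`. -/
def posUnitBall (B : OpStarSubalgebra H) : Set (H →L[ℂ] H) :=
  {b | b ∈ B ∧ b ∈ posCone B ∧ ‖b‖ ≤ 1}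

lemma isStarProjection_openProj (B : OpStarSubalgebra H) : IsStarProjection (openProj B) :=
  isStarProjection_starProjection

lemma apply_mem_closedRange {B : OpStarSubalgebra H} {b : H →L[ℂ] H} (hb : b ∈ B) (v : H) :
    b v ∈ closedRange B :=
  Submodule.le_topologicalClosure _ (Submodule.subset_span ⟨b, hb, v, rfl⟩)

lemma openProj_mul {B : OpStarSubalgebra H} {b : H →L[ℂ] H} (hb : b ∈ B) :
    openProj B * b = b := by
  ext v
  exact Submodule.starProjection_eq_self_iff.2 (apply_mem_closedRange hb v)

lemma mul_openProj {B : OpStarSubalgebra H} {b : H →L[ℂ] H} (hb : b ∈ B) :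
    b * openProj B = b := by
  have h := congrArg star (openProj_mul (star_mem hb))
  rwa [star_mul, star_star, (isStarProjection_openProj B).isSelfAdjoint.star_eq] at h

lemma map_closedRange {B : OpStarSubalgebra H} {x : H →L[ℂ] H} (hx : ∀ b ∈ B, b * x = x * b)
    {w : H} (hw : w ∈ closedRange B) : x w ∈ closedRange B := by
  refine map_mem_closure x.continuous hw ?_
  intro w hw
  induction hw using Submodule.span_induction with
  | mem w hw =>
    obtain ⟨b, hb, v, rfl⟩ := hw
    refine Submodule.subset_span ⟨b, hb, x v, ?_⟩
    exact congrArg (fun f : H →L[ℂ] H => f v) (hx b hb)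
  | zero => simp
  | add u v _ _ hu hv => rw [map_add]; exact add_mem hu hv
  | smul c u _ hu => rw [map_smul]; exact Submodule.smul_mem _ c hu

/-- If `B ⊆ A` then `p_B` lies in the double commutant `A''`. -/
lemma openProj_mem_doubleCommutant {A B : OpStarSubalgebra H} (hBA : B ≤ A) :
    openProj B ∈ Set.centralizer (Set.centralizer (A : Set (H →L[ℂ] H))) := by
  have key : ∀ x : H →L[ℂ] H, (∀ b ∈ B, b * x = x * b) →
      openProj B * (x * openProj B) = x * openProj B := by
    intro x hx
    ext v
    exact Submodule.starProjection_eq_self_iff.2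
      (map_closedRange hx (Submodule.starProjection_apply_mem _ v))
  intro x hx
  have hx1 : ∀ b ∈ B, b * x = x * b := fun b hb => hx b (hBA hb)
  have hx2 : ∀ b ∈ B, b * star x = star x * b := fun b hb => by
    have h := congrArg star (hx (star b) (hBA (star_mem hb)))
    simpa using h.symm
  have h1 := key x hx1
  have h2 := congrArg star (key (star x) hx2)
  simp only [star_mul, star_star, (isStarProjection_openProj B).isSelfAdjoint.star_eq] at h2
  rw [← h1, ← mul_assoc, h2]

/-- `p_B` is the supremum of the positive part of the unit ball of `B`, in the usual ordering of
operators on `H`. -/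
lemma isLUB_openProj (B : OpStarSubalgebra H) (hB : IsClosed (B : Set (H →L[ℂ] H))) :
    IsLUB (posUnitBall B) (openProj B) := by
  have hsa := (isStarProjection_openProj B).isSelfAdjoint.star_eq
  have hid := (isStarProjection_openProj B).isIdempotentElem.eq
  constructor
  · rintro b ⟨hb, ⟨c, -, rfl⟩, hn⟩
    have h1 : star c * c ≤ 1 :=
      (CStarAlgebra.norm_le_one_iff_of_nonneg _ (star_mul_self_nonneg c)).1 hn
    have h2 := star_left_conjugate_le_conjugate h1 (openProj B)
    rw [hsa, mul_one, hid, openProj_mul hb, mul_openProj hb] at h2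
    exact h2
  · intro x hx
    have : IsClosed (B : Set (H →L[ℂ] H)) := hB
    let _ : PartialOrder B := CStarAlgebra.spectralOrder B
    have : StarOrderedRing B := CStarAlgebra.spectralOrderedRing B
    have hu := CStarAlgebra.increasingApproximateUnit B
    have hmem : ∀ᶠ u : B in CStarAlgebra.approximateUnit B,
        (u : H →L[ℂ] H) ∈ posUnitBall B := by
      filter_upwards [hu.eventually_nonneg, hu.eventually_norm] with u h0 h1
      refine ⟨u.2, ?_, h1⟩
      obtain ⟨c, hc⟩ := CStarAlgebra.nonneg_iff_eq_star_mul_self.1 h0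
      exact ⟨c, c.2, congrArg Subtype.val hc⟩
    have hspan : ∀ w ∈ Submodule.span ℂ {w : H | ∃ b ∈ B, ∃ v, b v = w},
        Tendsto (fun u : B => (u : H →L[ℂ] H) w) (CStarAlgebra.approximateUnit B) (𝓝 w) := by
      intro w hw
      induction hw using Submodule.span_induction with
      | mem w hw =>
        obtain ⟨b, hb, v, rfl⟩ := hw
        have h1 := hu.tendsto_mul_right ⟨b, hb⟩
        have h2 := (continuous_subtype_val.tendsto _).comp h1
        exact ((ContinuousLinearMap.apply ℂ H v).continuous.tendsto _).comp h2
      | zero => simp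
      | add u v _ _ hu hv => simpa using hu.add hv
      | smul c u _ hu => simpa using hu.const_smul c
    -- the approximate unit converges strongly to the identity on the closed range of `B`
    have hstrong : ∀ w ∈ closedRange B,
        Tendsto (fun u : B => (u : H →L[ℂ] H) w) (CStarAlgebra.approximateUnit B) (𝓝 w) := by
      intro w hw
      rw [Metric.tendsto_nhds]
      intro ε hε
      obtain ⟨w', hw', hd⟩ := Metric.mem_closure_iff.1 hw (ε / 3) (by positivity)
      filter_upwards [Metric.tendsto_nhds.1 (hspan w' hw') (ε / 3) (by positivity), hmem]
        with u h1 h2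
      have h3 : dist ((u : H →L[ℂ] H) w) ((u : H →L[ℂ] H) w') ≤ dist w w' := by
        rw [dist_eq_norm, dist_eq_norm, ← map_sub]
        exact ((u : H →L[ℂ] H).le_of_opNorm_le h2.2.2 _).trans_eq (one_mul _)
      have h4 := dist_triangle4 ((u : H →L[ℂ] H) w) ((u : H →L[ℂ] H) w') w' w
      rw [dist_comm w' w] at h4
      linarith
    have hx0 : (0 : H →L[ℂ] H) ≤ x :=
      hx ⟨zero_mem B, ⟨0, zero_mem B, by simp⟩, by simp⟩
    rw [ContinuousLinearMap.le_def, ContinuousLinearMap.isPositive_def']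
    refine ⟨(IsSelfAdjoint.of_nonneg hx0).sub (isStarProjection_openProj B).isSelfAdjoint, ?_⟩
    intro v
    have hlim : Tendsto (fun u : B => RCLike.re (inner ℂ ((x - (u : H →L[ℂ] H)) v) v))
        (CStarAlgebra.approximateUnit B)
        (𝓝 (RCLike.re (inner ℂ ((x - openProj B) v) v))) := by
      refine (RCLike.continuous_re.tendsto _).comp (Tendsto.inner ?_ tendsto_const_nhds)
      have h1 := hstrong (openProj B v) (Submodule.starProjection_apply_mem _ v)
      have h2 : ∀ u : B, (u : H →L[ℂ] H) (openProj B v) = (u : H →L[ℂ] H) v := fun u =>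
        congrArg (fun f : H →L[ℂ] H => f v) (mul_openProj u.2)
      simp only [h2] at h1
      exact tendsto_const_nhds.sub h1
    refine ge_of_tendsto hlim ?_
    filter_upwards [hmem] with u hu1
    exact (hx hu1).2 v

end

/-! ### Section semicomplemented elements -/

/-- An element `p` of a poset with least element `0` is section `∧`-semicomplemented if every
`q > p` has a nonzero `r ≤ q` with `p ∧ r = 0`. -/
def IsSSC {P : Type*} [PartialOrder P] [OrderBot P] (p : P) : Prop :=
  ∀ q, p < q → ∃ r, r ≠ ⊥ ∧ r ≤ q ∧ IsGLB {p, r} ⊥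

/-- `B ∈ ℋ(A)` is `ε`-SSC if, for every `C ∈ ℋ(A)` with `B ⊊ C`, there is a nonzero `D ∈ ℋ(C)`
with `‖p_B p_D‖ < ε`. -/
def IsEpsSSC {H : Type*} [NormedAddCommGroup H] [InnerProductSpace ℂ H] [CompleteSpace H]
    {A : OpStarSubalgebra H} (B : HerSub A) (ε : ℝ) : Prop :=
  ∀ C : HerSub A, B < C → ∃ D : HerSub C.1, D ≠ ⊥ ∧ ‖openProj B.1 * openProj D.1‖ < ε

end

/-! The hypothesis `B = B^⊥⊥` is used once: for `C` strictly larger than `B` it yields `b ∈ B^⊥` and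
`c ∈ C` with `bc ≠ 0`. Cutting `b⋆` down by a positive part gives a nonzero `x ∈ A` with `Bx = 0`
such that the element `cc⋆` of `C` is bounded below by some `d > 0` on the range of `x`
(`exists_hasLowerBoundedCompression`).

Suppose every nonzero `D ∈ ℋ(C)` had `‖p_B p_D‖ ≥ ε`. Write `c` for the current element of `C`, and
apply this to a nonzero `D` supported on the closed range of `cx`. For `0 < t < ε` some vector `cxu`
has a `p_B`-component longer than `t‖cxu‖`, and a positive contraction `b ∈ B` detects this. After a
further cut-down of `x`, the form of `b` is at least `t²` times the squared norm on the whole range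
of `cx`. Replacing `c` by `(1 - b)c` keeps `⟪cxv, xv⟫`, because `bx = 0`, but multiplies the bound
on `‖cxv‖²` by `1 - t²` (`HasLowerBoundedCompression.step`). Iteration drives that bound to zero,
while Cauchy–Schwarz keeps it at least `d²`: a contradiction.

SSC is the case `ε = 1`: a nonzero element of `B ∩ D` would force `‖p_B p_D‖ ≥ 1`. -/

section

variable {H : Type*} [NormedAddCommGroup H] [InnerProductSpace ℂ H] [CompleteSpace H]

/-! ### Positive cones and heredity. -/

lemma nonneg_of_mem_posCone {A : OpStarSubalgebra H} {a : H →L[ℂ] H} (ha : a ∈ posCone A) :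
    0 ≤ a := by
  obtain ⟨x, -, rfl⟩ := ha
  exact star_mul_self_nonneg x

/-- The square root comes from the non-unital functional calculus, so it stays in `A`. Hence the
order defined through `posCone A` agrees on `A` with the operator order. -/
lemma mem_posCone_of_nonneg {A : OpStarSubalgebra H} (hA : IsClosed (A : Set (H →L[ℂ] H)))
    {a : H →L[ℂ] H} (ha : a ∈ A) (h0 : 0 ≤ a) : a ∈ posCone A := by
  have := hA
  refine ⟨CFC.sqrt a, ?_, ?_⟩
  · rw [CFC.sqrt, cfcₙ_nnreal_eq_real _ _ h0]
    exact cfcₙ_mem (𝕜' := ℂ) _ ha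
  · rw [(IsSelfAdjoint.of_nonneg (CFC.sqrt_nonneg a)).star_eq, CFC.sqrt_mul_sqrt_self a h0]

lemma posPart_mem {A : OpStarSubalgebra H} (hA : IsClosed (A : Set (H →L[ℂ] H)))
    {a : H →L[ℂ] H} (ha : a ∈ A) : a⁺ ∈ A := by
  have := hA
  exact cfcₙ_mem (𝕜' := ℂ) _ ha

lemma isHereditaryCStarSubalgebra_trans {A C D : OpStarSubalgebra H}
    (hC : IsHereditaryCStarSubalgebra A C) (hD : IsHereditaryCStarSubalgebra C D) :
    IsHereditaryCStarSubalgebra A D where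
  le := hD.le.trans hC.le
  isClosed := hD.isClosed
  hereditary a ha b hb hab hbD := by
    have hbC : b ∈ C := hD.le hbD
    have haC : a ∈ C := hC.hereditary a ha b hb hab hbC
    exact hD.hereditary a (mem_posCone_of_nonneg hC.isClosed haC (nonneg_of_mem_posCone ha))
      b (mem_posCone_of_nonneg hC.isClosed hbC (nonneg_of_mem_posCone hb))
      (mem_posCone_of_nonneg hC.isClosed (sub_mem hbC haC) (nonneg_of_mem_posCone hab)) hbD

/-- A hereditary C*-subalgebra `C` of `A` contains `c a c⋆` for `c ∈ C` and positive `a ∈ A`. -/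
lemma IsHereditaryCStarSubalgebra.mul_mul_star_mem {A C : OpStarSubalgebra H}
    (hA : IsClosed (A : Set (H →L[ℂ] H))) (hC : IsHereditaryCStarSubalgebra A C)
    {c x : H →L[ℂ] H} (hc : c ∈ C) (hx : x ∈ A) : c * x * star (c * x) ∈ C := by
  -- This is `xx⋆ ≤ ‖xx⋆‖·1` conjugated by `c`; the right side is a multiple of `cc⋆ ∈ C`.
  have hle : c * x * star (c * x) ≤ ((‖x * star x‖ : ℝ) : ℂ) • (c * star c) := by
    have h := star_right_conjugate_le_conjugate
      (IsSelfAdjoint.le_algebraMap_norm_self (IsSelfAdjoint.mul_star_self x)) c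
    refine le_of_eq_of_le ?_ (h.trans_eq ?_)
    · simp only [star_mul, mul_assoc]
    · rw [Algebra.algebraMap_eq_smul_one, mul_smul_comm, mul_one, smul_mul_assoc]
      rfl
  have h1 : c * x * star (c * x) ∈ A :=
    mul_mem (mul_mem (hC.le hc) hx) (star_mem (mul_mem (hC.le hc) hx))
  have h2 : ((‖x * star x‖ : ℝ) : ℂ) • (c * star c) ∈ C :=
    SMulMemClass.smul_mem _ (mul_mem hc (star_mem hc))
  have h0 : 0 ≤ c * x * star (c * x) := mul_star_self_nonneg _
  exact hC.hereditary _ (mem_posCone_of_nonneg hA h1 h0) _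
    (mem_posCone_of_nonneg hA (hC.le h2) (h0.trans hle))
    (mem_posCone_of_nonneg hA (sub_mem (hC.le h2) h1) (sub_nonneg.2 hle)) h2

/-! ### Corners under a projection. -/

/-- The elements of `C` that live under the self-adjoint operator `P`. -/
def cornerSub (C : OpStarSubalgebra H) (P : H →L[ℂ] H) (hP : IsSelfAdjoint P) :
    OpStarSubalgebra H where
  carrier := {y | y ∈ C ∧ P * y = y ∧ y * P = y}
  add_mem' := by
    rintro a b ⟨ha, ha1, ha2⟩ ⟨hb, hb1, hb2⟩
    exact ⟨add_mem ha hb, by rw [mul_add, ha1, hb1], by rw [add_mul, ha2, hb2]⟩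
  zero_mem' := ⟨zero_mem C, by simp, by simp⟩
  mul_mem' := by
    rintro a b ⟨ha, ha1, ha2⟩ ⟨hb, hb1, hb2⟩
    exact ⟨mul_mem ha hb, by rw [← mul_assoc, ha1], by rw [mul_assoc, hb2]⟩
  smul_mem' := by
    rintro z a ⟨ha, ha1, ha2⟩
    exact ⟨SMulMemClass.smul_mem z ha, by rw [mul_smul_comm, ha1], by rw [smul_mul_assoc, ha2]⟩
  star_mem' := by
    rintro a ⟨ha, ha1, ha2⟩
    refine ⟨star_mem ha, ?_, ?_⟩
    · simpa [hP.star_eq] using congrArg star ha2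
    · simpa [hP.star_eq] using congrArg star ha1

/-- If `0 ≤ s⋆s ≤ b` and `b(1 - P) = 0`, conjugating by `1 - P` gives `‖s(1 - P)‖ = 0`, so `s⋆s`
also lives under `P`. -/
lemma isHereditaryCStarSubalgebra_cornerSub {C : OpStarSubalgebra H}
    (hC : IsClosed (C : Set (H →L[ℂ] H))) {P : H →L[ℂ] H} (hP : IsSelfAdjoint P) :
    IsHereditaryCStarSubalgebra C (cornerSub C P hP) where
  le _ hy := hy.1
  isClosed := by
    refine hC.inter (IsClosed.inter ?_ ?_)
    · exact isClosed_eq (continuous_const.mul continuous_id) continuous_id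
    · exact isClosed_eq (continuous_id.mul continuous_const) continuous_id
  hereditary := by
    rintro _ ⟨s, hs, rfl⟩ b - hab ⟨-, -, hb⟩
    have h1 := star_left_conjugate_le_conjugate (sub_nonneg.1 (nonneg_of_mem_posCone hab)) (1 - P)
    have h2 : b * (1 - P) = 0 := by rw [mul_sub, hb, mul_one, sub_self]
    rw [mul_assoc _ b, h2, mul_zero] at h1
    have h3 : star (s * (1 - P)) * (s * (1 - P)) = 0 := by
      refine le_antisymm (le_of_eq_of_le ?_ h1) (star_mul_self_nonneg _)
      simp only [star_mul, mul_assoc]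
    have h4 : s * P = s := by
      have h := (CStarRing.star_mul_self_eq_zero_iff _).1 h3
      rw [mul_sub, mul_one, sub_eq_zero] at h
      exact h.symm
    have h5 : P * star s = star s := by simpa [hP.star_eq] using congrArg star h4
    exact ⟨mul_mem (star_mem hs) hs, by rw [← mul_assoc, h5], by rw [mul_assoc, h4]⟩

/-! ### Approximate units, cut-downs by positive parts, and angles between open projections. -/

/-- The positive contractions of `B` nearly attain the open projection at every vector. -/
lemma exists_posUnitBall_lt_inner {B : OpStarSubalgebra H} (hB : IsClosed (B : Set (H →L[ℂ] H)))
    {z : H} {r : ℝ} (hz : r < ‖openProj B z‖ ^ 2) :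
    ∃ b ∈ posUnitBall B, r < RCLike.re (inner ℂ (b z) z) := by
  have : IsClosed (B : Set (H →L[ℂ] H)) := hB
  let _ : PartialOrder B := CStarAlgebra.spectralOrder B
  have : StarOrderedRing B := CStarAlgebra.spectralOrderedRing B
  have hu := CStarAlgebra.increasingApproximateUnit B
  have hmem : ∀ᶠ u : B in CStarAlgebra.approximateUnit B,
      (u : H →L[ℂ] H) ∈ posUnitBall B := by
    filter_upwards [hu.eventually_nonneg, hu.eventually_norm] with u h0 h1
    refine ⟨u.2, ?_, h1⟩
    obtain ⟨c, hc⟩ := CStarAlgebra.nonneg_iff_eq_star_mul_self.1 h0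
    exact ⟨c, c.2, congrArg Subtype.val hc⟩
  have hspan : ∀ w ∈ Submodule.span ℂ {w : H | ∃ b ∈ B, ∃ v, b v = w},
      Tendsto (fun u : B => (u : H →L[ℂ] H) w) (CStarAlgebra.approximateUnit B) (𝓝 w) := by
    intro w hw
    induction hw using Submodule.span_induction with
    | mem w hw =>
      obtain ⟨b, hb, v, rfl⟩ := hw
      have h1 := hu.tendsto_mul_right ⟨b, hb⟩
      have h2 := (continuous_subtype_val.tendsto _).comp h1
      exact ((ContinuousLinearMap.apply ℂ H v).continuous.tendsto _).comp h2
    | zero => simp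
    | add u v _ _ hu hv => simpa using hu.add hv
    | smul c u _ hu => simpa using hu.const_smul c
  have hstrong : Tendsto (fun u : B => (u : H →L[ℂ] H) (openProj B z))
      (CStarAlgebra.approximateUnit B) (𝓝 (openProj B z)) := by
    have hw : openProj B z ∈ closedRange B := Submodule.starProjection_apply_mem _ z
    rw [Metric.tendsto_nhds]
    intro ε hε
    obtain ⟨w', hw', hd⟩ := Metric.mem_closure_iff.1 hw (ε / 3) (by positivity)
    filter_upwards [Metric.tendsto_nhds.1 (hspan w' hw') (ε / 3) (by positivity), hmem]
      with u h1 h2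
    have h3 : dist ((u : H →L[ℂ] H) (openProj B z)) ((u : H →L[ℂ] H) w')
        ≤ dist (openProj B z) w' := by
      rw [dist_eq_norm, dist_eq_norm, ← map_sub]
      exact ((u : H →L[ℂ] H).le_of_opNorm_le h2.2.2 _).trans_eq (one_mul _)
    have h4 := dist_triangle4 ((u : H →L[ℂ] H) (openProj B z)) ((u : H →L[ℂ] H) w') w'
      (openProj B z)
    rw [dist_comm w' (openProj B z)] at h4
    linarith
  have hnorm : RCLike.re (inner ℂ (openProj B z) z) = ‖openProj B z‖ ^ 2 := by
    exact Submodule.re_inner_starProjection_eq_normSq _ z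
  have hlim : Tendsto (fun u : B => RCLike.re (inner ℂ ((u : H →L[ℂ] H) z) z))
      (CStarAlgebra.approximateUnit B) (𝓝 (‖openProj B z‖ ^ 2)) := by
    rw [← hnorm]
    refine (RCLike.continuous_re.tendsto _).comp (Tendsto.inner ?_ tendsto_const_nhds)
    -- Since `u p_B = u`, convergence at `p_B z` is convergence of `u z` to `p_B z`.
    refine hstrong.congr fun u => ?_
    exact congrArg (fun f : H →L[ℂ] H => f z) (mul_openProj u.2)
  obtain ⟨u, hu1, hu2⟩ := (hmem.and (hlim.eventually (lt_mem_nhds hz))).exists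
  exact ⟨u, hu1, hu2⟩

/-- If the compression `x⋆Sx` is not negative, then `x` can be cut down so that it is positive. -/
lemma exists_mul_ne_zero_inner_nonneg {A : OpStarSubalgebra H}
    (hA : IsClosed (A : Set (H →L[ℂ] H))) {x S : H →L[ℂ] H} (hS : IsSelfAdjoint S)
    (hxS : star x * S * x ∈ A) {u : H} (hu : 0 < RCLike.re (inner ℂ (S (x u)) (x u))) :
    ∃ h ∈ A, x * h ≠ 0 ∧
      ∀ v, 0 ≤ RCLike.re (inner ℂ (S ((x * h) v)) ((x * h) v)) := by
  set T := star x * S * x with hT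
  have hinner : ∀ w, inner ℂ (T w) w = inner ℂ (S (x w)) (x w) := by
    intro w
    change inner ℂ (ContinuousLinearMap.adjoint x (S (x w))) w = _
    rw [ContinuousLinearMap.adjoint_inner_left]
  have hTs : IsSelfAdjoint T := hS.conjugate' x
  have hsub := CFC.posPart_sub_negPart T hTs
  have hneg : T⁻ * T⁺ = 0 := CFC.negPart_mul_posPart T
  have hpos : 0 ≤ T⁺ := CFC.posPart_nonneg T
  have hTT : T * T⁺ = T⁺ * T⁺ := by
    nth_rw 1 [← hsub]
    rw [sub_mul, hneg, sub_zero]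
  -- With `h = T⁺`, the form of `S` at `xhv` is that of `T⁺` at `T⁺v`. If `xT⁺ = 0`, then `T⁺ = 0`
  -- and `T = -T⁻ ≤ 0`, contradicting `hu`.
  refine ⟨T⁺, posPart_mem hA hxS, ?_, ?_⟩
  · intro h0
    have h1 : T⁺ * T⁺ = 0 := by rw [← hTT, hT, mul_assoc, h0, mul_zero]
    have h2 : T⁺ = 0 := by
      rw [← CStarRing.star_mul_self_eq_zero_iff, (IsSelfAdjoint.of_nonneg hpos).star_eq, h1]
    have h3 := (ContinuousLinearMap.nonneg_iff_isPositive _).1 (CFC.negPart_nonneg T)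
    have h4 := h3.re_inner_nonneg_left u
    rw [h2, zero_sub] at hsub
    rw [← hinner, ← hsub] at hu
    simp only [neg_apply, inner_neg_left, map_neg] at hu
    linarith
  · intro v
    have h3 := ((ContinuousLinearMap.nonneg_iff_isPositive _).1 hpos).re_inner_nonneg_left (T⁺ v)
    have h4 : T (T⁺ v) = T⁺ (T⁺ v) := congrArg (fun f : H →L[ℂ] H => f v) hTT
    change 0 ≤ RCLike.re (inner ℂ (S (x (T⁺ v))) (x (T⁺ v)))
    rw [← hinner, h4]
    exact h3

/-- `D` is the corner of `C` under the projection onto the closed range of `cx`. Although `cx` need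
not lie in `C`, heredity puts `cx(cx)⋆` there, so the corner is nonzero. -/
lemma exists_herSub_closedRange_le {A C : OpStarSubalgebra H}
    (hA : IsClosed (A : Set (H →L[ℂ] H))) (hC : IsHereditaryCStarSubalgebra A C)
    {c x : H →L[ℂ] H} (hc : c ∈ C) (hx : x ∈ A) (hcx : c * x ≠ 0) :
    ∃ D : HerSub C, D ≠ ⊥ ∧
      closedRange D.1 ≤ (LinearMap.range (c * x : H →L[ℂ] H).toLinearMap).topologicalClosure := by
  set K := (LinearMap.range (c * x : H →L[ℂ] H).toLinearMap).topologicalClosure with hK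
  have hKc : IsClosed (K : Set H) := Submodule.isClosed_topologicalClosure _
  have : CompleteSpace K := hKc.completeSpace_coe
  have hP : IsSelfAdjoint K.starProjection := isStarProjection_starProjection.isSelfAdjoint
  have he : K.starProjection * (c * x * star (c * x)) = c * x * star (c * x) := by
    ext v
    refine Submodule.starProjection_eq_self_iff.2 (Submodule.le_topologicalClosure _ ?_)
    exact ⟨star (c * x) v, rfl⟩
  have he' : c * x * star (c * x) * K.starProjection = c * x * star (c * x) := by
    simpa [hP.star_eq, mul_assoc] using congrArg star he
  refine ⟨⟨cornerSub C K.starProjection hP,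
    isHereditaryCStarSubalgebra_cornerSub hC.isClosed hP⟩, ?_, ?_⟩
  · intro h
    have hmem : c * x * star (c * x) ∈ cornerSub C K.starProjection hP :=
      ⟨hC.mul_mul_star_mem hA hc hx, he, he'⟩
    have hval : cornerSub C K.starProjection hP = zeroSub H :=
      congrArg (Subtype.val : HerSub C → OpStarSubalgebra H) h
    rw [hval] at hmem
    exact hcx (CStarRing.mul_star_self_eq_zero_iff _ |>.1 hmem)
  · refine Submodule.topologicalClosure_minimal _ (Submodule.span_le.2 ?_) hKc
    rintro _ ⟨b, hb, v, rfl⟩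
    have hbv : K.starProjection (b v) = b v := congrArg (fun f : H →L[ℂ] H => f v) hb.2.1
    exact Submodule.starProjection_eq_self_iff.1 hbv

lemma norm_openProj_mul_openProj_le {B D : OpStarSubalgebra H} {y : H →L[ℂ] H} {t : ℝ}
    (ht : 0 ≤ t) (hD : closedRange D ≤ (LinearMap.range y.toLinearMap).topologicalClosure)
    (h : ∀ v, ‖openProj B (y v)‖ ≤ t * ‖y v‖) : ‖openProj B * openProj D‖ ≤ t := by
  have hcl : ∀ w ∈ (LinearMap.range y.toLinearMap).topologicalClosure,
      ‖openProj B w‖ ≤ t * ‖w‖ := by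
    intro w hw
    have hclosed : IsClosed {w : H | ‖openProj B w‖ ≤ t * ‖w‖} :=
      isClosed_le (openProj B).continuous.norm (continuous_const.mul continuous_norm)
    refine closure_minimal ?_ hclosed hw
    rintro _ ⟨v, rfl⟩
    exact h v
  refine ContinuousLinearMap.opNorm_le_bound _ ht fun v => ?_
  refine (hcl _ (hD (Submodule.starProjection_apply_mem _ v))).trans ?_
  exact mul_le_mul_of_nonneg_left (Submodule.norm_starProjection_apply_le _ v) ht

/-! ### The shrinking argument. -/

/-- A nonzero `x ∈ A` with `B x = 0` and some `c ∈ C` which, on the range of `x`, has numerical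
values of real part at least `d` but norm at most `√M`. -/
def HasLowerBoundedCompression (A B C : OpStarSubalgebra H) (d M : ℝ) : Prop :=
  ∃ x ∈ A, x ≠ 0 ∧ (∀ b ∈ B, b * x = 0) ∧ ∃ c ∈ C, ∀ v,
    d * ‖x v‖ ^ 2 ≤ RCLike.re (inner ℂ (c (x v)) (x v)) ∧ ‖c (x v)‖ ^ 2 ≤ M * ‖x v‖ ^ 2

/-- Cauchy–Schwarz at a nonzero vector of the range of `x`. This is the obstruction to shrinking `M`
forever with `d` fixed. -/
lemma HasLowerBoundedCompression.sq_le {A B C : OpStarSubalgebra H} {d M : ℝ} (hd : 0 < d)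
    (h : HasLowerBoundedCompression A B C d M) : d ^ 2 ≤ M := by
  obtain ⟨x, -, hx0, -, c, -, hc⟩ := h
  obtain ⟨v, hv⟩ : ∃ v, x v ≠ 0 := by
    by_contra! hn
    exact hx0 (ContinuousLinearMap.ext hn)
  have hpos : 0 < ‖x v‖ := norm_pos_iff.2 hv
  have h1 := (hc v).1.trans (re_inner_le_norm (c (x v)) (x v))
  have h2 : d * ‖x v‖ ≤ ‖c (x v)‖ := by
    refine le_of_mul_le_mul_right ?_ hpos
    calc d * ‖x v‖ * ‖x v‖ = d * ‖x v‖ ^ 2 := by ring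
      _ ≤ _ := h1
  have h3 := (pow_le_pow_left₀ (by positivity) h2 2).trans (hc v).2
  rw [mul_pow] at h3
  exact le_of_mul_le_mul_right h3 (by positivity)

/-- Expand the square and use `b² ≤ b`. -/
lemma norm_sub_apply_sq_le {b : H →L[ℂ] H} (hb0 : 0 ≤ b) (hb1 : ‖b‖ ≤ 1) (z : H) :
    ‖z - b z‖ ^ 2 ≤ ‖z‖ ^ 2 - RCLike.re (inner ℂ (b z) z) := by
  have hsa : IsSelfAdjoint b := IsSelfAdjoint.of_nonneg hb0
  have h1 : b * b ≤ b := by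
    have h := CStarAlgebra.pow_antitone hb0
      ((CStarAlgebra.norm_le_one_iff_of_nonneg b).1 hb1) (show 1 ≤ 2 by norm_num)
    simpa [pow_two] using h
  have h2 := ((ContinuousLinearMap.le_def _ _).1 h1).re_inner_nonneg_left z
  have h3 : inner ℂ ((b * b) z) z = inner ℂ (b z) (b z) := by
    change inner ℂ (b (b z)) z = _
    rw [← ContinuousLinearMap.adjoint_inner_right, ← ContinuousLinearMap.star_eq_adjoint,
      hsa.star_eq]
  rw [sub_apply, inner_sub_left, map_sub, h3, inner_self_eq_norm_sq] at h2
  rw [norm_sub_sq (𝕜 := ℂ), inner_re_symm]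
  linarith

/-- If no `D ∈ ℋ(C)` makes a small angle with `B`, then `M` can be shrunk by a fixed factor:
replacing `c` by `(1 - b) c`, for a positive contraction `b ∈ B`, does not change `⟪c x v, x v⟫`
because `b x = 0`, but shrinks `c x v`. -/
lemma HasLowerBoundedCompression.step {A : OpStarSubalgebra H}
    (hA : IsClosed (A : Set (H →L[ℂ] H))) {B C : HerSub A} (hBC : B ≤ C) {ε t d M : ℝ}
    (ht : 0 ≤ t) (ht1 : t ≤ 1) (htε : t < ε) (hd : 0 < d)
    (hε : ∀ D : HerSub C.1, D ≠ ⊥ → ε ≤ ‖openProj B.1 * openProj D.1‖)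
    (h : HasLowerBoundedCompression A B.1 C.1 d M) :
    HasLowerBoundedCompression A B.1 C.1 d (M * (1 - t ^ 2)) := by
  obtain ⟨x, hxA, hx0, hBx, c, hcC, hc⟩ := h
  have hcx : c * x ≠ 0 := by
    intro h0
    obtain ⟨v, hv⟩ : ∃ v, x v ≠ 0 := by
      by_contra! hn
      exact hx0 (ContinuousLinearMap.ext hn)
    have h1 := (hc v).1
    have h2 : c (x v) = 0 := congrArg (fun f : H →L[ℂ] H => f v) h0
    rw [h2, inner_zero_left, map_zero] at h1
    have hpos : 0 < ‖x v‖ := norm_pos_iff.2 hv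
    have : 0 < d * ‖x v‖ ^ 2 := by positivity
    linarith
  obtain ⟨D, hD0, hDr⟩ := exists_herSub_closedRange_le hA C.2 hcC hxA hcx
  obtain ⟨u, hu⟩ : ∃ u, t * ‖(c * x) u‖ < ‖openProj B.1 ((c * x) u)‖ := by
    by_contra! hn
    exact absurd (norm_openProj_mul_openProj_le ht hDr hn) (not_le.2 (htε.trans_le (hε D hD0)))
  have hu2 : t ^ 2 * ‖(c * x) u‖ ^ 2 < ‖openProj B.1 ((c * x) u)‖ ^ 2 := by
    rw [← mul_pow]
    exact pow_lt_pow_left₀ hu (by positivity) two_ne_zero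
  obtain ⟨b, ⟨hbB, hbpos, hb1⟩, hbu⟩ := exists_posUnitBall_lt_inner B.2.isClosed hu2
  have hb0 : 0 ≤ b := nonneg_of_mem_posCone hbpos
  -- Nonnegativity of the form of `S` on the range of the cut-down `x` says that `b` keeps at least
  -- the fraction `t²` there.
  set S : H →L[ℂ] H := star c * (b - algebraMap ℝ _ (t ^ 2)) * c with hSdef
  have hSinner : ∀ w, RCLike.re (inner ℂ (S w) w)
      = RCLike.re (inner ℂ (b (c w)) (c w)) - t ^ 2 * ‖c w‖ ^ 2 := by
    intro w
    change RCLike.re (inner ℂ (ContinuousLinearMap.adjoint c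
      ((b - algebraMap ℝ (H →L[ℂ] H) (t ^ 2)) (c w))) w) = _
    rw [ContinuousLinearMap.adjoint_inner_left, sub_apply, inner_sub_left, map_sub,
      Algebra.algebraMap_eq_smul_one]
    congr 1
    change RCLike.re (inner ℂ ((t ^ 2 : ℝ) • c w) (c w)) = _
    rw [inner_smul_left_eq_smul, RCLike.smul_re, inner_self_eq_norm_sq]
  have hSsa : IsSelfAdjoint S :=
    ((IsSelfAdjoint.of_nonneg hb0).sub (IsSelfAdjoint.algebraMap _ (.all _))).conjugate' c
  have hxSx : star x * S * x ∈ A := by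
    have h1 : star x * S * x
        = star (c * x) * b * (c * x) - ((t ^ 2 : ℝ) : ℂ) • (star (c * x) * (c * x)) := by
      have h2 : algebraMap ℝ (H →L[ℂ] H) (t ^ 2) = ((t ^ 2 : ℝ) : ℂ) • 1 := by
        rw [Algebra.algebraMap_eq_smul_one]
        rfl
      rw [hSdef, h2]
      simp only [star_mul, mul_sub, sub_mul, mul_assoc, smul_mul_assoc, mul_smul_comm, one_mul]
    have h3 : c * x ∈ A := mul_mem (C.2.le hcC) hxA
    rw [h1]
    exact sub_mem (mul_mem (mul_mem (star_mem h3) (B.2.le hbB)) h3)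
      (SMulMemClass.smul_mem _ (mul_mem (star_mem h3) h3))
  obtain ⟨h, hhA, hxh, hpos⟩ := exists_mul_ne_zero_inner_nonneg hA hSsa hxSx (u := u) (by
    rw [hSinner]
    exact sub_pos.2 hbu)
  refine ⟨x * h, mul_mem hxA hhA, hxh, fun b' hb' => by rw [← mul_assoc, hBx b' hb', zero_mul],
    c - b * c, sub_mem hcC (mul_mem (hBC hbB) hcC), fun v => ?_⟩
  have hv := hc (h v)
  have hpv := hpos v
  rw [hSinner] at hpv
  change d * ‖x (h v)‖ ^ 2 ≤ RCLike.re (inner ℂ (c (x (h v)) - b (c (x (h v)))) (x (h v))) ∧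
    ‖c (x (h v)) - b (c (x (h v)))‖ ^ 2 ≤ M * (1 - t ^ 2) * ‖x (h v)‖ ^ 2
  change 0 ≤ RCLike.re (inner ℂ (b (c (x (h v)))) (c (x (h v)))) - t ^ 2 * ‖c (x (h v))‖ ^ 2 at hpv
  constructor
  · have h1 : b (x (h v)) = 0 := congrArg (fun f : H →L[ℂ] H => f (h v)) (hBx b hbB)
    have h2 : inner ℂ (b (c (x (h v)))) (x (h v)) = 0 := by
      rw [← ContinuousLinearMap.adjoint_inner_right, ← ContinuousLinearMap.star_eq_adjoint,
        (IsSelfAdjoint.of_nonneg hb0).star_eq, h1, inner_zero_right]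
    rw [inner_sub_left, h2, sub_zero]
    exact hv.1
  · have h1 := norm_sub_apply_sq_le hb0 hb1 (c (x (h v)))
    have h2 : 0 ≤ 1 - t ^ 2 := by nlinarith
    calc ‖c (x (h v)) - b (c (x (h v)))‖ ^ 2 ≤ (1 - t ^ 2) * ‖c (x (h v))‖ ^ 2 := by linarith
      _ ≤ (1 - t ^ 2) * (M * ‖x (h v)‖ ^ 2) := mul_le_mul_of_nonneg_left hv.2 h2
      _ = _ := by ring

/-- If `B^⊥` annihilated `C` on the left, then `C ⊆ B^⊥⊥ = B`. So some product `bc` is nonzero, and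
`x` is obtained by cutting `b⋆` down to where `cc⋆ ≥ d`. -/
lemma exists_hasLowerBoundedCompression {A : OpStarSubalgebra H}
    (hA : IsClosed (A : Set (H →L[ℂ] H))) {B C : HerSub A}
    (hB : (B.1 : Set (H →L[ℂ] H)) = starAnnihilator A (starAnnihilator A B.1)) (hBC : B < C) :
    ∃ d M : ℝ, 0 < d ∧ HasLowerBoundedCompression A B.1 C.1 d M := by
  obtain ⟨c₁, hc₁C, hc₁B⟩ := SetLike.exists_of_lt (show B.1 < C.1 from hBC)
  obtain ⟨b, hb, c, hcC, hbc⟩ :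
      ∃ b ∈ starAnnihilator A (B.1 : Set (H →L[ℂ] H)), ∃ c ∈ C.1, b * c ≠ 0 := by
    by_contra! hn
    refine hc₁B ?_
    rw [← SetLike.mem_coe, hB]
    exact ⟨C.2.le hc₁C, fun b hb => ⟨hn b hb c₁ hc₁C, hn b hb _ (star_mem hc₁C)⟩⟩
  obtain ⟨u, hu⟩ : ∃ u, star c (star b u) ≠ 0 := by
    by_contra! hn
    refine hbc (star_eq_zero.1 ?_)
    rw [star_mul]
    exact ContinuousLinearMap.ext hn
  have hcc : ∀ w, RCLike.re (inner ℂ ((c * star c) w) w) = ‖star c w‖ ^ 2 := by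
    intro w
    change RCLike.re (inner ℂ (c (star c w)) w) = _
    rw [← ContinuousLinearMap.adjoint_inner_right, ← ContinuousLinearMap.star_eq_adjoint,
      inner_self_eq_norm_sq]
  have hpos : 0 < ‖star c (star b u)‖ := norm_pos_iff.2 hu
  have hy : 0 < ‖star b u‖ := by
    refine norm_pos_iff.2 fun h0 => hu ?_
    rw [h0, map_zero]
  -- Half the Rayleigh quotient of `cc⋆` at `b⋆u`, so that `cc⋆ - d` is strictly positive at that
  -- vector.
  set d : ℝ := ‖star c (star b u)‖ ^ 2 / (2 * ‖star b u‖ ^ 2) with hd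
  have hd0 : 0 < d := by positivity
  set S : H →L[ℂ] H := c * star c - algebraMap ℝ _ d with hSdef
  have hSinner : ∀ w, RCLike.re (inner ℂ (S w) w)
      = RCLike.re (inner ℂ ((c * star c) w) w) - d * ‖w‖ ^ 2 := by
    intro w
    rw [hSdef, sub_apply, inner_sub_left, map_sub, Algebra.algebraMap_eq_smul_one]
    congr 1
    change RCLike.re (inner ℂ (d • w) w) = _
    rw [inner_smul_left_eq_smul, RCLike.smul_re, inner_self_eq_norm_sq]
  have hSsa : IsSelfAdjoint S :=
    (IsSelfAdjoint.mul_star_self c).sub (IsSelfAdjoint.algebraMap _ (.all _))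
  have hbA : star b ∈ A := star_mem hb.1
  -- `A` may lack the identity, so `S` itself need not lie in `A`; its compression does.
  have hxSx : star (star b) * S * star b ∈ A := by
    have h1 : star (star b) * S * star b
        = b * (c * star c) * star b - ((d : ℝ) : ℂ) • (b * star b) := by
      have h2 : algebraMap ℝ (H →L[ℂ] H) d = ((d : ℝ) : ℂ) • 1 := by
        rw [Algebra.algebraMap_eq_smul_one]
        rfl
      rw [hSdef, h2]
      simp only [star_star, mul_sub, sub_mul, mul_assoc, smul_mul_assoc, mul_smul_comm, one_mul]
    have h3 : c ∈ A := C.2.le hcC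
    rw [h1]
    exact sub_mem (mul_mem (mul_mem hb.1 (mul_mem h3 (star_mem h3))) hbA)
      (SMulMemClass.smul_mem _ (mul_mem hb.1 hbA))
  obtain ⟨h, hhA, hxh, hnn⟩ := exists_mul_ne_zero_inner_nonneg hA hSsa hxSx (u := u) (by
    have hdy : d * ‖star b u‖ ^ 2 = ‖star c (star b u)‖ ^ 2 / 2 := by
      rw [hd]
      field_simp
    have : 0 < ‖star c (star b u)‖ ^ 2 := by positivity
    rw [hSinner, hcc, hdy]
    linarith)
  refine ⟨d, ‖c * star c‖ ^ 2, hd0, star b * h, mul_mem hbA hhA, hxh,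
    fun b' hb' => by rw [← mul_assoc, (hb.2 b' hb').2, zero_mul],
    c * star c, mul_mem hcC (star_mem hcC), fun v => ⟨?_, ?_⟩⟩
  · have h1 := hnn v
    rw [hSinner] at h1
    linarith
  · rw [← mul_pow]
    exact pow_le_pow_left₀ (norm_nonneg _) (ContinuousLinearMap.le_opNorm _ _) 2

/-- A hereditary C*-subalgebra that equals its double annihilator is `ε`-SSC for every `ε`. -/
lemma isEpsSSC_of_eq_starAnnihilator {A : OpStarSubalgebra H}
    (hA : IsClosed (A : Set (H →L[ℂ] H))) {B : HerSub A}
    (hB : (B.1 : Set (H →L[ℂ] H)) = starAnnihilator A (starAnnihilator A B.1))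
    {ε : ℝ} (hε : 0 < ε) : IsEpsSSC B ε := by
  intro C hBC
  by_contra! hn
  obtain ⟨d, M, hd, hM⟩ := exists_hasLowerBoundedCompression hA hB hBC
  -- `t < ε` gives the strict inequality that yields a vector at each step; `0 < t < 1` puts the
  -- factor `1 - t²` strictly between 0 and 1.
  obtain ⟨t, ht0, ht⟩ := exists_between (lt_min hε one_pos)
  have ht1 : t < 1 := ht.trans_le (min_le_right _ _)
  have hiter : ∀ n : ℕ, HasLowerBoundedCompression A B.1 C.1 d (M * (1 - t ^ 2) ^ n) := by
    intro n
    induction n with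
    | zero => simpa using hM
    | succ n ih =>
      rw [pow_succ, ← mul_assoc]
      exact ih.step hA hBC.le ht0.le ht1.le (ht.trans_le (min_le_left _ _)) hd hn
  have hlim : Tendsto (fun n : ℕ => M * (1 - t ^ 2) ^ n) atTop (𝓝 (M * 0)) :=
    (tendsto_pow_atTop_nhds_zero_of_lt_one (by nlinarith) (by nlinarith)).const_mul M
  have hle := ge_of_tendsto' hlim fun n => (hiter n).sq_le hd
  rw [mul_zero] at hle
  have : 0 < d ^ 2 := by positivity
  linarith

/-! ### From angles to semicomplements. -/

/-- A common element satisfies `e = p_B p_D e`, so `‖e‖ ≤ ‖p_B p_D‖ ‖e‖`. -/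
lemma eq_zero_of_mem_of_norm_openProj_mul_lt_one {B D : OpStarSubalgebra H}
    (h : ‖openProj B * openProj D‖ < 1) {e : H →L[ℂ] H} (heB : e ∈ B) (heD : e ∈ D) : e = 0 := by
  by_contra he
  have h1 : openProj B * openProj D * e = e := by
    rw [mul_assoc, openProj_mul heD, openProj_mul heB]
  have h2 := norm_mul_le (openProj B * openProj D) e
  rw [h1] at h2
  have h3 : 0 < ‖e‖ := norm_pos_iff.2 he
  nlinarith

lemma IsEpsSSC.isSSC {A : OpStarSubalgebra H} {B : HerSub A} (hB : IsEpsSSC B 1) : IsSSC B := by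
  intro C hBC
  obtain ⟨D, hD0, hD⟩ := hB C hBC
  refine ⟨⟨D.1, isHereditaryCStarSubalgebra_trans C.2 D.2⟩, ?_, D.2.le, ?_⟩
  · intro h
    exact hD0 (Subtype.ext (congrArg (Subtype.val : HerSub A → OpStarSubalgebra H) h))
  · refine ⟨fun _ _ => bot_le, fun E hE e he => ?_⟩
    exact eq_zero_of_mem_of_norm_openProj_mul_lt_one hD (hE (Set.mem_insert _ _) he)
      (hE (Set.mem_insert_of_mem _ rfl) he)

end

theorem mainTheorem4 {H : Type*} [NormedAddCommGroup H] [InnerProductSpace ℂ H] [CompleteSpace H]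
    (A : OpStarSubalgebra H) (hA : IsClosed (A : Set (H →L[ℂ] H))) (B : HerSub A)
    (hB : (B.1 : Set (H →L[ℂ] H)) = starAnnihilator A (starAnnihilator A B.1)) :
    (∀ ε : ℝ, 0 < ε → IsEpsSSC B ε) ∧ IsSSC B :=
  ⟨fun _ hε => isEpsSSC_of_eq_starAnnihilator hA hB hε,
    (isEpsSSC_of_eq_starAnnihilator hA hB one_pos).isSSC⟩
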